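/- Let $\Omega\subset\mathbb{R}^2$ be open and simply connected, with coordinates $x,y$ and a Riemannian metric $h=e^{2u}(dx^2+dy^2)$, $u\in C^\infty(\Omega)$ (a simply connected domain of a surface in isothermal coordinates; $u=0$ is the flat case). Put $e_1=e^{-u}\partial_x$, $e_2=e^{-u}\partial_y$. Trivialize the spinor bundle by this frame, so that spinors are $\mathbb{C}^2$-valued functions with the standard hermitian product $\langle\cdot,\cdot\rangle$ (conjugate-linear in the first slot, linear in the second), Clifford multiplication is $e_1\cdot=\begin{pmatrix}0&1\\-1&0\end{pmatrix}$, $e_2\cdot=\begin{pmatrix}0&i\\i&0\end{pmatrix}$, $\partial_x\cdot=e^u e_1\cdot$, $\partial_y\cdot=e^ue_2\cdot$, and $\slashed{\partial}=e_\alpha\cdot\nabla_{e_\alpha}$ is the Dirac operator of $h$. Write $\Delta_h$ and $|d\phi|_h$ for the Laplace–Beltrami operator and the norm with respect to $h$, and $f_x,f_y$ for partial derivatives; repeated indices are summed. Let $\kappa\in\mathbb{R}$ and let $(\phi,\psi)$ be a smooth $\kappa$-Dirac-harmonic map from $\Omega$ to $S^n\subset\mathbb{R}^{n+1}$, that is,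 $\phi\colon\Omega\to S^n$ and $\psi=(\psi^1,\dots,\psi^{n+1})$, $\psi^i\colon\Omega\to\mathbb{C}^2$, are smooth, $\phi^i\psi^i=0$, and for $i=1,\dots,n+1$ $$-\Delta_h\phi^i=|d\phi|_h^2\phi^i+\operatorname{Re}\langle\psi^i,e_\alpha\cdot\psi^j\rangle\, d\phi^j(e_\alpha),$$ $$\slashed{\partial}\psi^i=-\phi^i\,d\phi^j(e_\alpha)\,e_\alpha\cdot\psi^j-2\kappa\big(|\psi|^2\psi^i-\langle\psi^j,\psi^i\rangle\psi^j\big),\qquad |\psi|^2=\sum_j|\psi^j|^2 .$$ For $\alpha\in\{x,y\}$ put $S_\alpha^{im}=\operatorname{Re}\langle\psi^i,\partial_\alpha\cdot\psi^m\rangle$ and let $J_\alpha^{im}=\operatorname{Re}\langle\partial_\alpha\cdot\psi^i,\psi^m\rangle+\phi^i_\alpha\phi^m-\phi^i\phi^m_\alpha$ be the Noether current. Then there exist smooth functions $B^{mi}\colon\Omega\to\mathbb{R}$, $1\le m,i\le n+1$, with $$B^{mi}_x=-J^{im}_y,\qquad B^{mi}_y=J^{im}_x,$$ that satisfy $$\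begin{aligned}B^{mi}_{xx}+B^{mi}_{yy}={}&2\big(B^{mj}_xB^{ji}_y-B^{mj}_yB^{ji}_x\big)-\partial_xS_y^{im}+\partial_yS_x^{im}+2\big(S_x^{ij}S_y^{jm}-S_y^{ij}S_x^{jm}\big)\\&+4\kappa\operatorname{Re}\big(2|\psi|^2\langle\partial_x\cdot\partial_y\cdot\psi^i,\psi^m\rangle-\langle\psi^i,\psi^j\rangle\langle\partial_x\cdot\partial_y\cdot\psi^j,\psi^m\rangle+\langle\psi^i,\partial_x\cdot\partial_y\cdot\psi^j\rangle\langle\psi^j,\psi^m\rangle\big)\end{aligned}$$ and $$\sum_{m,i}(B^{mi}_x)^2=\sum_{i,m}(S_y^{im})^2+2|\phi_y|^2,\qquad \sum_{m,i}(B^{mi}_y)^2=\sum_{i,m}(S_x^{im})^2+2|\phi_x|^2,$$ $$\sum_{m,i}B^{mi}_xB^{mi}_y=-\sum_{i,m}S_x^{im}S_y^{im}-2\,\phi^i_x\phi^i_y .$$ -/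

import Mathlib

open scoped ContDiff

noncomputable section

namespace DiracHarmonic

/-- The coordinate plane; the coordinates are `x = p 0` and `y = p 1`. -/
abbrev Plane : Type := EuclideanSpace ℝ (Fin 2)

/-- The fibre of the spinor bundle of a surface, with its standard hermitian product
(Mathlib's `inner ℂ` is conjugate-linear in the first slot and linear in the second). -/
abbrev Spinor : Type := EuclideanSpace ℂ (Fin 2)

/-- The coordinate derivative `∂f/∂x^α`. -/
def pd {E : Type*} [NormedAddCommGroup E] [NormedSpace ℝ E]
    (α : Fin 2) (f : Plane → E) (p : Plane) : E :=
  fderiv ℝ f p (EuclideanSpace.single α 1)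

/-!
The domain is an open set of the plane with the metric `h = exp (2 u) (dx² + dy²)`, that is, a
domain of a surface in isothermal coordinates (`u = 0` is the flat metric). The orthonormal frame is
`e_α = exp (-u) ∂_α`, and the spinor bundle is trivialized by this frame.
-/

/-- Clifford multiplication by the orthonormal frame vector `e_α`. -/
def frameMul (α : Fin 2) : Spinor →L[ℂ] Spinor :=
  Matrix.toEuclideanCLM (𝕜 := ℂ)
    ((![!![0, 1; -1, 0], !![0, Complex.I; Complex.I, 0]] :
      Fin 2 → Matrix (Fin 2) (Fin 2) ℂ) α)

/-- Clifford multiplication by the coordinate vector `∂_α = exp u • e_α` at the point `p`. -/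
def coordMul (u : Plane → ℝ) (α : Fin 2) (p : Plane) (s : Spinor) : Spinor :=
  Real.exp (u p) • frameMul α s

/-- The derivative `df (e_α)` along the orthonormal frame. -/
def frameDeriv {E : Type*} [NormedAddCommGroup E] [NormedSpace ℝ E]
    (u : Plane → ℝ) (α : Fin 2) (f : Plane → E) (p : Plane) : E :=
  Real.exp (-u p) • pd α f p

/-- The Levi-Civita connection form `h (∇_{∂_α} e_1, e_2)` of the metric `exp (2 u) (dx² + dy²)`
in its orthonormal frame: it is `-∂u/∂y` for `∂_x` and `∂u/∂x` for `∂_y`. -/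
def connForm (u : Plane → ℝ) (α : Fin 2) (p : Plane) : ℝ :=
  ![-pd 1 u p, pd 0 u p] α

/-- The spin connection
`∇_{∂_α} s = ∂_α s + (1/2) h (∇_{∂_α} e_1, e_2) e_1 · e_2 · s`. -/
def spinDeriv (u : Plane → ℝ) (α : Fin 2) (s : Plane → Spinor) (p : Plane) : Spinor :=
  pd α s p + (1 / 2 * connForm u α p) • frameMul 0 (frameMul 1 (s p))

/-- The Dirac operator `e_α · ∇_{e_α}` of the metric `exp (2 u) (dx² + dy²)`. -/
def dirac (u : Plane → ℝ) (s : Plane → Spinor) (p : Plane) : Spinor :=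
  ∑ α, frameMul α (Real.exp (-u p) • spinDeriv u α s p)

/-- The Laplacian `∂²/∂x² + ∂²/∂y²` of the coordinates. -/
def coordLaplacian (f : Plane → ℝ) (p : Plane) : ℝ :=
  ∑ α, pd α (pd α f) p

/-- The Laplace-Beltrami operator of the metric `exp (2 u) (dx² + dy²)` on functions. -/
def laplaceBeltrami (u : Plane → ℝ) (f : Plane → ℝ) (p : Plane) : ℝ :=
  Real.exp (-2 * u p) * coordLaplacian f p

/-- `(φ, ψ)` is a smooth `κ`-Dirac-harmonic map from `Ω`, with the metric `exp (2 u) (dx² + dy²)`,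
to the round unit sphere of `ℝ^(n+1)`. The vector spinor `ψ` along `φ` is given by its components
`ψ i` in `ℝ^(n+1)`; the field `tangent` says that it takes values in the pulled-back tangent
bundle of the sphere. -/
structure IsSmoothKappaDiracHarmonic (n : ℕ) (κ : ℝ) (u : Plane → ℝ) (Ω : Set Plane)
    (φ : Plane → EuclideanSpace ℝ (Fin (n + 1))) (ψ : Fin (n + 1) → Plane → Spinor) :
    Prop where
  smooth_map : ContDiffOn ℝ ∞ φ Ω
  smooth_spinor : ∀ i, ContDiffOn ℝ ∞ (ψ i) Ω
  mem_sphere : ∀ p ∈ Ω, φ p ∈ Metric.sphere (0 : EuclideanSpace ℝ (Fin (n + 1))) 1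
  tangent : ∀ p ∈ Ω, ∑ i, φ p i • ψ i p = 0
  map_eq : ∀ p ∈ Ω, ∀ i,
    -laplaceBeltrami u (fun q => φ q i) p =
      (∑ α, ‖frameDeriv u α φ p‖ ^ 2) * φ p i
        + ∑ α, ∑ j, (inner ℂ (ψ i p) (frameMul α (ψ j p))).re
            * frameDeriv u α (fun q => φ q j) p
  spinor_eq : ∀ p ∈ Ω, ∀ i,
    dirac u (ψ i) p =
      -(φ p i • ∑ α, ∑ j, frameDeriv u α (fun q => φ q j) p • frameMul α (ψ j p))
        - (2 * κ) • ((∑ j, ‖ψ j p‖ ^ 2) • ψ i p - ∑ j, inner ℂ (ψ j p) (ψ i p) • ψ j p)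

/-- The spinor bilinear `Re ⟨ψ^i, ∂_α · ψ^m⟩`. -/
def bilin {n : ℕ} (u : Plane → ℝ) (ψ : Fin (n + 1) → Plane → Spinor)
    (α : Fin 2) (i m : Fin (n + 1)) (p : Plane) : ℝ :=
  (inner ℂ (ψ i p) (coordMul u α p (ψ m p))).re

/-- The Noether current
`J_α^{im} = Re ⟨∂_α · ψ^i, ψ^m⟩ + φ^i_α φ^m - φ^i φ^m_α` in the coordinates. -/
def noetherCurrent {n : ℕ} (u : Plane → ℝ) (φ : Plane → EuclideanSpace ℝ (Fin (n + 1)))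
    (ψ : Fin (n + 1) → Plane → Spinor) (α : Fin 2) (i m : Fin (n + 1)) (p : Plane) : ℝ :=
  (inner ℂ (coordMul u α p (ψ i p)) (ψ m p)).re
    + (pd α (fun q => φ q i) p * φ p m - φ p i * pd α (fun q => φ q m) p)

/-- The quartic spinor term
`Re (2 |ψ|² ⟨∂_x·∂_y·ψ^i, ψ^m⟩ - ⟨ψ^i, ψ^j⟩ ⟨∂_x·∂_y·ψ^j, ψ^m⟩ + ⟨ψ^i, ∂_x·∂_y·ψ^j⟩ ⟨ψ^j, ψ^m⟩)`,
summed over `j`. -/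
def quarticTerm {n : ℕ} (u : Plane → ℝ) (ψ : Fin (n + 1) → Plane → Spinor)
    (i m : Fin (n + 1)) (p : Plane) : ℝ :=
  (2 * ((∑ j, ‖ψ j p‖ ^ 2 : ℝ) : ℂ)
        * inner ℂ (coordMul u 0 p (coordMul u 1 p (ψ i p))) (ψ m p)
      - ∑ j, inner ℂ (ψ i p) (ψ j p)
          * inner ℂ (coordMul u 0 p (coordMul u 1 p (ψ j p))) (ψ m p)
      + ∑ j, inner ℂ (ψ i p) (coordMul u 0 p (coordMul u 1 p (ψ j p)))
          * inner ℂ (ψ j p) (ψ m p)).re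

end DiracHarmonic

end

/-! The target is homogeneous under rotations, so the Noether current `J = -S + φ_α ∧ φ` is
divergence-free, and `B` is its stream function. Its Laplacian is then the curl of `J`, and the
proof consists in computing that curl.

Second derivatives of `φ` cancel, leaving `2(φ^i_x φ^m_y - φ^i_y φ^m_x)` and the curl of `S`.
Clifford relations express the divergence and curl of `S` through the Dirac operator (`div_bilin`,
`curl_bilin`), the conformal factor being absorbed exactly; the spinor equation then evaluates both
(`div_bilin_eq`, `curl_bilin_eq`). The quartic potential drops out of the divergence by symmetry but
survives in the curl. Finally `|φ| = 1`, `φ ⊥ φ_α` and `Sφ = 0` reduce the quadratic expressions in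
`J` to quadratic expressions in `S` and `dφ` plus the mixed terms found in the curl of `S`
(`sum_current_mul_current`). The same algebra, traced, gives the energy identities. -/

/-! ### Exactness of closed 1-forms on simply connected open sets -/

open Topology Filter in
/-- A closed 1-form on a simply connected open set is exact. -/
theorem IsOpen.exists_forall_hasFDerivAt_of_fderiv_symmetric {E F : Type*}
    [NormedAddCommGroup E] [NormedSpace ℝ E] [NormedAddCommGroup F] [NormedSpace ℝ F]
    [CompleteSpace F] {Ω : Set E} (hΩ : IsOpen Ω) (hsc : SimplyConnectedSpace Ω)
    {η : E → E →L[ℝ] F} (hη : DifferentiableOn ℝ η Ω)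
    (hdη : ∀ a ∈ Ω, ∀ x y, fderiv ℝ η a x y = fderiv ℝ η a y x) :
    ∃ f : E → F, ∀ a ∈ Ω, HasFDerivAt f (η a) a := by
  classical
  have hloc (x : Ω) : ∃ r : ℝ, 0 < r ∧ Metric.ball (x : E) r ⊆ Ω ∧
      ∃ f : E → F, ∀ a ∈ Metric.ball (x : E) r, HasFDerivAt f (η a) a := by
    obtain ⟨r, hr, hball⟩ := Metric.isOpen_iff.mp hΩ x x.2
    exact ⟨r, hr, hball, (convex_ball (x : E) r).exists_forall_hasFDerivAt_of_fderiv_symmetric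
      Metric.isOpen_ball (hη.mono hball) fun a ha => hdη a (hball ha)⟩
  choose r hr hball f hf using hloc
  let U (x : Ω) : Set Ω := Subtype.val ⁻¹' Metric.ball (x : E) (r x)
  have hUo (x : Ω) : IsOpen (U x) := Metric.isOpen_ball.preimage continuous_subtype_val
  -- Intersections of balls are convex, so two local primitives differ there by a single constant.
  have hconst (i j : Ω) (x y : E) (hx : x ∈ Metric.ball (i : E) (r i) ∩ Metric.ball (j : E) (r j))
      (hy : y ∈ Metric.ball (i : E) (r i) ∩ Metric.ball (j : E) (r j)) :
      f i x - f j x = f i y - f j y := by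
    have hconv := (convex_ball (i : E) (r i)).inter (convex_ball (j : E) (r j))
    have hopen : IsOpen (Metric.ball (i : E) (r i) ∩ Metric.ball (j : E) (r j)) :=
      Metric.isOpen_ball.inter Metric.isOpen_ball
    have hd (z) (hz : z ∈ Metric.ball (i : E) (r i) ∩ Metric.ball (j : E) (r j)) :
        HasFDerivAt (fun z => f i z - f j z) (0 : E →L[ℝ] F) z := by
      simpa using (hf i z hz.1).fun_sub (hf j z hz.2)
    refine hconv.is_const_of_fderivWithin_eq_zero (𝕜 := ℝ) (f := fun z => f i z - f j z)
      (fun z hz => (hd z hz).differentiableAt.differentiableWithinAt) (fun z hz => ?_) hx hy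
    rw [fderivWithin_of_isOpen hopen hz, (hd z hz).fderiv]
  -- `D` is a copy of `F` with the discrete topology, kept apart from the norm topology of `F`.
  obtain ⟨D, _, _, ⟨e⟩⟩ : ∃ (D : Type _) (_ : TopologicalSpace D) (_ : DiscreteTopology D),
      Nonempty (D ≃ F) := ⟨F, ⊥, @DiscreteTopology.mk F ⊥ rfl, ⟨Equiv.refl F⟩⟩
  -- The covering space of germs of primitives: the coordinate `t` in chart `i` stands for the
  -- primitive `f i + t`, which dictates the transition `t + (f i - f j)`.
  let Z : FiberBundleCore Ω Ω D :=
    { baseSet := U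
      isOpen_baseSet := hUo
      indexAt := id
      mem_baseSet_at := fun x => Metric.mem_ball_self (hr x)
      coordChange := fun i j x t => e.symm (e t + (f i x - f j x))
      coordChange_self := fun i x _ t => by simp
      continuousOn_coordChange := fun i j => by
        rintro ⟨x, t⟩ ⟨hx, -⟩
        refine ContinuousAt.continuousWithinAt ?_
        have hnhds : {z : Ω × D | z.1 ∈ U i ∩ U j ∧ z.2 = t} ∈ 𝓝 (x, t) := by
          have h1 : U i ∩ U j ∈ 𝓝 x := ((hUo i).inter (hUo j)).mem_nhds hx
          have h2 : ({t} : Set D) ∈ 𝓝 t := (isOpen_discrete _).mem_nhds rfl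
          exact Filter.mem_of_superset (prod_mem_nhds h1 h2) fun z hz => hz
        refine (continuousAt_const (y := e.symm (e t + (f i x - f j x)))).congr ?_
        filter_upwards [hnhds] with z hz
        obtain ⟨hz1, hz2⟩ := hz
        rw [hz2, hconst i j x z.1 hx hz1]
      coordChange_comp := fun i j k x _ t => by
        simp only [Equiv.apply_symm_apply, add_assoc, sub_add_sub_cancel] }
  have hcov : IsCoveringMap (Bundle.TotalSpace.proj : Bundle.TotalSpace D Z.Fiber → Ω) := by
    exact FiberBundle.isCoveringMap (F := D) (E := Z.Fiber)
  have : LocallyPathConnectedSpace Ω := hΩ.locallyPathConnectedSpace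
  obtain ⟨x₀⟩ : Nonempty Ω := inferInstance
  -- Simple connectedness enters here: the identity of `Ω` lifts to a global section, that is, a
  -- coherent choice of primitive.
  obtain ⟨s, ⟨-, hs⟩, -⟩ := hcov.existsUnique_continuousMap_lifts (ContinuousMap.id Ω) x₀
    ⟨x₀, e.symm 0⟩ rfl
  have hsp (x : Ω) : (s x).1 = x := congrFun hs x
  let τ : Ω → D := fun x => (s x).2
  let g : Ω → F := fun x => e (τ x) + f (s x).1 x
  refine ⟨fun a => if h : a ∈ Ω then g ⟨a, h⟩ else 0, fun a ha => ?_⟩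
  let a' : Ω := ⟨a, ha⟩
  have hcont : ContinuousAt (fun x : Ω => (Z.localTriv a' (s x)).2) a' := by
    have hsrc : s a' ∈ (Z.localTriv a').source := by
      rw [Z.mem_localTriv_source, hsp]
      exact Metric.mem_ball_self (hr a')
    exact continuous_snd.continuousAt.comp
      (((Z.localTriv a').continuousAt hsrc).comp s.continuous.continuousAt)
  have hev : ∀ᶠ x in 𝓝 a', (Z.localTriv a' (s x)).2 = (Z.localTriv a' (s a')).2 :=
    hcont.eventually_mem ((isOpen_discrete {(Z.localTriv a' (s a')).2}).mem_nhds rfl)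
  -- Read in the fixed chart at `a'`, `g` is the local primitive plus the fibre coordinate of the
  -- section, which is locally constant.
  have hval (x : Ω) : g x = e (Z.localTriv a' (s x)).2 + f a' x := by
    change e (τ x) + f (s x).1 x =
      e (e.symm (e (τ x) + (f (s x).1 (s x).1 - f a' (s x).1))) + f a' x
    rw [e.apply_symm_apply, hsp x]
    abel
  have hev' : ∀ᶠ z in 𝓝 a, (if h : z ∈ Ω then g ⟨z, h⟩ else 0)
      = e (Z.localTriv a' (s a')).2 + f a' z := by
    have : ∀ᶠ z in 𝓝 a, ∃ h : z ∈ Ω,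
        (Z.localTriv a' (s ⟨z, h⟩)).2 = (Z.localTriv a' (s a')).2 := by
      rw [← hΩ.isOpenEmbedding_subtypeVal.map_nhds_eq a']
      exact Filter.eventually_map.mpr (hev.mono fun x hx => ⟨x.2, hx⟩)
    filter_upwards [this] with z hz
    obtain ⟨h, hz⟩ := hz
    rw [dif_pos h, hval, hz]
  exact ((hf a' a (Metric.mem_ball_self (hr a'))).const_add _).congr_of_eventuallyEq hev'

namespace DiracHarmonic

open scoped Topology

/-! ### Algebra of products of currents -/

section Currents

variable {ι : Type*} [Fintype ι]

/-- The contraction of two currents `-S + a ∧ v` and `-T + b ∧ v` whose spinor parts annihilate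
the unit vector `v` and whose vector parts are orthogonal to it. -/
theorem sum_current_mul_current {S T : ι → ι → ℝ} {v a b : ι → ℝ} (hv : ∑ j, v j * v j = 1)
    (ha : ∑ j, v j * a j = 0) (hb : ∑ j, v j * b j = 0)
    (hS : ∀ m, ∑ j, v j * S j m = 0) (hT : ∀ i, ∑ j, T i j * v j = 0) (i m : ι) :
    ∑ j, (-S j m + (a j * v m - v j * a m)) * (-T i j + (b i * v j - v i * b j)) =
      ∑ j, T i j * S j m - v m * ∑ j, T i j * a j + v i * ∑ j, b j * S j m
        - b i * a m - v i * v m * ∑ j, a j * b j := by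
  have key : ∀ j, (-S j m + (a j * v m - v j * a m)) * (-T i j + (b i * v j - v i * b j)) =
      T i j * S j m - v m * (T i j * a j) + v i * (b j * S j m) - b i * a m * (v j * v j)
        - v i * v m * (a j * b j) - b i * (v j * S j m) + a m * (T i j * v j)
        + v m * b i * (v j * a j) + a m * v i * (v j * b j) := fun j => by ring
  simp only [key, Finset.sum_add_distrib, Finset.sum_sub_distrib, ← Finset.mul_sum, hv, ha, hb,
    hS, hT]
  ring

/-- For antisymmetric matrices the entrywise product is minus the trace of the matrix product, so
this is the diagonal of `sum_current_mul_current`, summed. The mixed terms die because antisymmetry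
lets `S` and `T` act on `v`. -/
theorem sum_sum_current_mul_current {S T : ι → ι → ℝ} {v a b : ι → ℝ} (hv : ∑ j, v j * v j = 1)
    (ha : ∑ j, v j * a j = 0) (hb : ∑ j, v j * b j = 0)
    (hS : ∀ m, ∑ j, v j * S j m = 0) (hT : ∀ i, ∑ j, T i j * v j = 0)
    (hSa : ∀ i m, S m i = -S i m) (hTa : ∀ i m, T m i = -T i m) :
    ∑ m, ∑ i, (-S i m + (a i * v m - v i * a m)) * (-T i m + (b i * v m - v i * b m)) =
      ∑ i, ∑ m, S i m * T i m + 2 * ∑ i, a i * b i := by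
  have hT' : ∑ m, v m * ∑ j, T m j * a j = 0 := by
    simp only [Finset.mul_sum]
    rw [Finset.sum_comm]
    refine Finset.sum_eq_zero fun j _ => ?_
    have h1 : ∀ m, v m * (T m j * a j) = -a j * (T j m * v m) := fun m => by
      rw [hTa j m]; ring
    simp only [h1, ← Finset.mul_sum, hT, mul_zero]
  have hS' : ∑ m, v m * ∑ j, b j * S j m = 0 := by
    simp only [Finset.mul_sum]
    rw [Finset.sum_comm]
    refine Finset.sum_eq_zero fun j _ => ?_
    have h1 : ∀ m, v m * (b j * S j m) = -b j * (v m * S m j) := fun m => by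
      rw [hSa j m]; ring
    simp only [h1, ← Finset.mul_sum, hS, mul_zero]
  have h1 (m : ι) : ∑ i, (-S i m + (a i * v m - v i * a m)) * (-T i m + (b i * v m - v i * b m)) =
      ∑ j, S j m * T j m + v m * ∑ j, T m j * a j - v m * ∑ j, b j * S j m
        + a m * b m + v m * v m * ∑ j, a j * b j := by
    have h2 := sum_current_mul_current hv ha hb hS hT m m
    have h3 : ∑ j, T m j * S j m = -∑ j, S j m * T j m := by
      rw [← Finset.sum_neg_distrib]
      exact Finset.sum_congr rfl fun j _ => by rw [hTa j m]; ring
    rw [h3] at h2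
    rw [← neg_inj, ← Finset.sum_neg_distrib]
    refine (Finset.sum_congr rfl fun j _ => ?_).trans (h2.trans (by ring))
    rw [hTa j m]; ring
  simp only [h1, Finset.sum_add_distrib, Finset.sum_sub_distrib, ← Finset.sum_mul, hS', hT', hv]
  rw [Finset.sum_comm (f := fun m j => S j m * T j m)]
  ring

end Currents

/-! ### Clifford relations and the conformal Dirac operator -/

section Clifford

theorem frameMul_zero_apply (s : Spinor) : frameMul 0 s = !₂[s 1, -s 0] := by
  ext k
  fin_cases k <;> simp [frameMul, Matrix.ofLp_toEuclideanCLM, Matrix.mulVec, dotProduct]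

theorem frameMul_one_apply (s : Spinor) :
    frameMul 1 s = !₂[Complex.I * s 1, Complex.I * s 0] := by
  ext k
  fin_cases k <;> simp [frameMul, Matrix.ofLp_toEuclideanCLM, Matrix.mulVec, dotProduct]

theorem frameMul_zero_zero (s : Spinor) : frameMul 0 (frameMul 0 s) = -s := by
  ext k
  fin_cases k <;> simp [frameMul_zero_apply]

theorem frameMul_one_one (s : Spinor) : frameMul 1 (frameMul 1 s) = -s := by
  ext k
  fin_cases k <;> simp [frameMul_one_apply, ← mul_assoc]

theorem frameMul_one_zero (s : Spinor) :
    frameMul 1 (frameMul 0 s) = -frameMul 0 (frameMul 1 s) := by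
  ext k
  fin_cases k <;> simp [frameMul_zero_apply, frameMul_one_apply]

/-- Clifford multiplication by a frame vector is skew-hermitian. -/
theorem inner_frameMul_left (α : Fin 2) (s t : Spinor) :
    inner ℂ (frameMul α s) t = -inner ℂ s (frameMul α t) := by
  fin_cases α <;>
    simp [frameMul_zero_apply, frameMul_one_apply, PiLp.inner_apply, Fin.sum_univ_two] <;> ring

theorem frameMul_real_smul (α : Fin 2) (c : ℝ) (s : Spinor) :
    frameMul α (c • s) = c • frameMul α s := by
  rw [← Complex.coe_smul, map_smul, Complex.coe_smul]

theorem re_inner_real_smul_left (c : ℝ) (s t : Spinor) :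
    (inner ℂ (c • s) t).re = c * (inner ℂ s t).re := by
  rw [← Complex.coe_smul, inner_smul_left, Complex.conj_ofReal, Complex.re_ofReal_mul]

theorem re_inner_real_smul_right (c : ℝ) (s t : Spinor) :
    (inner ℂ s (c • t)).re = c * (inner ℂ s t).re := by
  rw [← Complex.coe_smul, inner_smul_right, Complex.re_ofReal_mul]

theorem re_inner_comm (s t : Spinor) : (inner ℂ s t).re = (inner ℂ t s).re := by
  rw [← inner_conj_symm, Complex.conj_re]

theorem re_inner_frameMul_antisymm (α : Fin 2) (s t : Spinor) :
    (inner ℂ t (frameMul α s)).re = -(inner ℂ s (frameMul α t)).re := by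
  rw [re_inner_comm, inner_frameMul_left, Complex.neg_re]

/-- The Dirac operator of the conformal metric in terms of the flat one. -/
theorem exp_smul_dirac (u : Plane → ℝ) (s : Plane → Spinor) (p : Plane) :
    Real.exp (u p) • dirac u s p = frameMul 0 (pd 0 s p) + frameMul 1 (pd 1 s p)
      + (1 / 2 : ℝ) • (pd 0 u p • frameMul 0 (s p) + pd 1 u p • frameMul 1 (s p)) := by
  have h : dirac u s p = Real.exp (-u p) • (frameMul 0 (pd 0 s p) + frameMul 1 (pd 1 s p)
      + (1 / 2 : ℝ) • (pd 0 u p • frameMul 0 (s p) + pd 1 u p • frameMul 1 (s p))) := by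
    -- Since `e₁e₁e₂ = -e₂` and `e₂e₁e₂ = e₁`, the connection form `(-u_y, u_x)` contributes half of
    -- Clifford multiplication by the gradient of `u`.
    simp only [dirac, spinDeriv, connForm, Fin.sum_univ_two, frameMul_real_smul, map_add,
      frameMul_zero_zero, frameMul_one_zero, frameMul_one_one, map_neg,
      Matrix.cons_val_zero, Matrix.cons_val_one]
    module
  rw [h, smul_smul, ← Real.exp_add, add_neg_cancel, Real.exp_zero, one_smul]

end Clifford

/-! ### Calculus of coordinate derivatives -/

section Derivatives

variable {E : Type*} [NormedAddCommGroup E] [NormedSpace ℝ E]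

theorem pd_congr {α : Fin 2} {f g : Plane → E} {p : Plane} (h : f =ᶠ[𝓝 p] g) :
    pd α f p = pd α g p := by
  rw [pd, pd, h.fderiv_eq]

theorem contDiffOn_pd {Ω : Set Plane} (hΩ : IsOpen Ω) {f : Plane → E}
    (hf : ContDiffOn ℝ ∞ f Ω) (α : Fin 2) : ContDiffOn ℝ ∞ (pd α f) Ω :=
  ((contDiffOn_infty_iff_fderiv_of_isOpen hΩ).mp hf).2.clm_apply contDiffOn_const

theorem pd_comm {Ω : Set Plane} (hΩ : IsOpen Ω) {f : Plane → E}
    (hf : ContDiffOn ℝ ∞ f Ω) {p : Plane} (hp : p ∈ Ω) (α β : Fin 2) :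
    pd α (pd β f) p = pd β (pd α f) p := by
  have hd : DifferentiableAt ℝ (fderiv ℝ f) p :=
    (((contDiffOn_infty_iff_fderiv_of_isOpen hΩ).mp hf).2.differentiableOn (by simp)).differentiableAt
      (hΩ.mem_nhds hp)
  have h1 (α β : Fin 2) : pd α (pd β f) p = fderiv ℝ (fderiv ℝ f) p (EuclideanSpace.single α 1)
      (EuclideanSpace.single β 1) := by
    change fderiv ℝ (fun q => fderiv ℝ f q (EuclideanSpace.single β 1)) p _ = _
    rw [fderiv_clm_apply hd (differentiableAt_const _)]
    simp
  rw [h1, h1]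
  exact ((hf.contDiffAt (hΩ.mem_nhds hp)).isSymmSndFDerivAt
    (by rw [minSmoothness_of_isRCLikeNormedField]; exact WithTop.coe_le_coe.mpr (le_top : (2 : ℕ∞) ≤ ⊤))) _ _

theorem pd_add {α : Fin 2} {f g : Plane → E} {p : Plane} (hf : DifferentiableAt ℝ f p)
    (hg : DifferentiableAt ℝ g p) : pd α (fun q => f q + g q) p = pd α f p + pd α g p := by
  rw [pd, fderiv_fun_add hf hg]; rfl

theorem pd_sub {α : Fin 2} {f g : Plane → E} {p : Plane} (hf : DifferentiableAt ℝ f p)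
    (hg : DifferentiableAt ℝ g p) : pd α (fun q => f q - g q) p = pd α f p - pd α g p := by
  rw [pd, fderiv_fun_sub hf hg]; rfl

theorem pd_neg {α : Fin 2} {f : Plane → E} {p : Plane} :
    pd α (fun q => -f q) p = -pd α f p := by
  rw [pd, fderiv_fun_neg]; rfl

theorem pd_mul {α : Fin 2} {f g : Plane → ℝ} {p : Plane} (hf : DifferentiableAt ℝ f p)
    (hg : DifferentiableAt ℝ g p) :
    pd α (fun q => f q * g q) p = f p * pd α g p + pd α f p * g p := by
  rw [pd, fderiv_fun_mul hf hg]
  simp [pd, mul_comm]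

theorem pd_apply {ι : Type*} [Fintype ι] {α : Fin 2} {f : Plane → EuclideanSpace ℝ ι} {p : Plane}
    (hf : DifferentiableAt ℝ f p) (i : ι) : pd α (fun q => f q i) p = pd α f p i := by
  have h := (EuclideanSpace.proj (𝕜 := ℝ) i).hasFDerivAt.comp p hf.hasFDerivAt
  exact congrArg (fun L => L (EuclideanSpace.single α 1)) h.fderiv

theorem pd_bilin {n : ℕ} {u : Plane → ℝ} {ψ : Fin (n + 1) → Plane → Spinor} {p : Plane}
    (hu : DifferentiableAt ℝ u p) (hψ : ∀ i, DifferentiableAt ℝ (ψ i) p) (α β : Fin 2)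
    (i m : Fin (n + 1)) :
    pd β (bilin u ψ α i m) p = Real.exp (u p) *
      (pd β u p * (inner ℂ (ψ i p) (frameMul α (ψ m p))).re
        + (inner ℂ (ψ i p) (frameMul α (pd β (ψ m) p))).re
        - (inner ℂ (ψ m p) (frameMul α (pd β (ψ i) p))).re) := by
  have hγ : HasFDerivAt (fun q => frameMul α (ψ m q))
      (((frameMul α).restrictScalars ℝ).comp (fderiv ℝ (ψ m) p)) p :=
    ((frameMul α).restrictScalars ℝ).hasFDerivAt.comp p (hψ m).hasFDerivAt
  have hin := Complex.reCLM.hasFDerivAt.comp p ((hψ i).hasFDerivAt.inner ℂ hγ)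
  have hprod := (hu.hasFDerivAt.exp).fun_mul hin
  have hfun : bilin u ψ α i m =
      fun q => Real.exp (u q) * (inner ℂ (ψ i q) (frameMul α (ψ m q))).re := by
    funext q
    rw [bilin, coordMul, re_inner_real_smul_right]
  rw [hfun, pd, HasFDerivAt.fderiv (f := fun q => _ * (inner ℂ _ _).re) hprod]
  have h2 := re_inner_frameMul_antisymm α (pd β (ψ i) p) (ψ m p)
  simp [pd] at h2 ⊢
  rw [h2]
  ring

end Derivatives

/-! ### Divergence and curl of the spinor bilinears -/

section Bilinears

variable {n : ℕ} {u : Plane → ℝ} {ψ : Fin (n + 1) → Plane → Spinor} {p : Plane}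

theorem bilin_eq (u : Plane → ℝ) (ψ : Fin (n + 1) → Plane → Spinor) (α : Fin 2)
    (i m : Fin (n + 1)) (p : Plane) :
    bilin u ψ α i m p = Real.exp (u p) * (inner ℂ (ψ i p) (frameMul α (ψ m p))).re := by
  rw [bilin, coordMul, re_inner_real_smul_right]

theorem bilin_antisymm (u : Plane → ℝ) (ψ : Fin (n + 1) → Plane → Spinor) (α : Fin 2)
    (i m : Fin (n + 1)) (p : Plane) : bilin u ψ α m i p = -bilin u ψ α i m p := by
  rw [bilin_eq, bilin_eq, re_inner_frameMul_antisymm, mul_neg]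

theorem contDiffOn_bilin {Ω : Set Plane} (hu : ContDiffOn ℝ ∞ u Ω)
    (hψ : ∀ i, ContDiffOn ℝ ∞ (ψ i) Ω) (α : Fin 2) (i m : Fin (n + 1)) :
    ContDiffOn ℝ ∞ (bilin u ψ α i m) Ω := by
  have h : bilin u ψ α i m =
      fun q => Real.exp (u q) * (inner ℂ (ψ i q) (frameMul α (ψ m q))).re :=
    funext (bilin_eq u ψ α i m)
  rw [h]
  exact hu.exp.mul (Complex.reCLM.contDiff.comp_contDiffOn ((hψ i).inner ℂ
    (((frameMul α).restrictScalars ℝ).contDiff.comp_contDiffOn (hψ m))))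

theorem noetherCurrent_eq (u : Plane → ℝ) (φ : Plane → EuclideanSpace ℝ (Fin (n + 1)))
    (ψ : Fin (n + 1) → Plane → Spinor) (α : Fin 2) (i m : Fin (n + 1)) (p : Plane) :
    noetherCurrent u φ ψ α i m p = -bilin u ψ α i m p
      + (pd α (fun q => φ q i) p * φ p m - φ p i * pd α (fun q => φ q m) p) := by
  rw [noetherCurrent, bilin_eq, coordMul, re_inner_real_smul_left, inner_frameMul_left,
    Complex.neg_re, mul_neg]

theorem exp_mul_re_inner_dirac (s : Spinor) (m : Fin (n + 1)) :
    Real.exp (u p) * (inner ℂ s (dirac u (ψ m) p)).re =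
      (inner ℂ s (frameMul 0 (pd 0 (ψ m) p))).re + (inner ℂ s (frameMul 1 (pd 1 (ψ m) p))).re
        + 1 / 2 * (pd 0 u p * (inner ℂ s (frameMul 0 (ψ m p))).re
          + pd 1 u p * (inner ℂ s (frameMul 1 (ψ m p))).re) := by
  rw [← re_inner_real_smul_right, exp_smul_dirac]
  simp only [inner_add_right, Complex.add_re, re_inner_real_smul_right]

/-- The volume element turns the divergence-type operator into a curl-type one: `e₁e₂(e₁∂_x + e₂∂_y)
= e₂∂_x - e₁∂_y`. -/
theorem exp_mul_re_inner_volume_dirac (s : Spinor) (m : Fin (n + 1)) :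
    Real.exp (u p) * (inner ℂ s (frameMul 0 (frameMul 1 (dirac u (ψ m) p)))).re =
      (inner ℂ s (frameMul 1 (pd 0 (ψ m) p))).re - (inner ℂ s (frameMul 0 (pd 1 (ψ m) p))).re
        + 1 / 2 * (pd 0 u p * (inner ℂ s (frameMul 1 (ψ m p))).re
          - pd 1 u p * (inner ℂ s (frameMul 0 (ψ m p))).re) := by
  rw [← re_inner_real_smul_right, ← frameMul_real_smul, ← frameMul_real_smul, exp_smul_dirac]
  simp only [map_add, map_neg, frameMul_real_smul, frameMul_one_zero, frameMul_one_one,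
    frameMul_zero_zero, neg_neg, smul_neg, inner_add_right, inner_neg_right, Complex.add_re,
    Complex.neg_re, re_inner_real_smul_right]
  ring

/-- The derivative of the weight `exp u` yields one full gradient term of `u`; each of the two Dirac
terms supplies half of it, so no connection term remains. -/
theorem div_bilin (hu : DifferentiableAt ℝ u p) (hψ : ∀ i, DifferentiableAt ℝ (ψ i) p)
    (i m : Fin (n + 1)) :
    pd 0 (bilin u ψ 0 i m) p + pd 1 (bilin u ψ 1 i m) p = Real.exp (u p) ^ 2 *
      ((inner ℂ (ψ i p) (dirac u (ψ m) p)).re - (inner ℂ (ψ m p) (dirac u (ψ i) p)).re) := by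
  have h1 := exp_mul_re_inner_dirac (u := u) (ψ := ψ) (p := p) (ψ i p) m
  have h2 := exp_mul_re_inner_dirac (u := u) (ψ := ψ) (p := p) (ψ m p) i
  rw [re_inner_frameMul_antisymm 0 (ψ i p) (ψ m p),
    re_inner_frameMul_antisymm 1 (ψ i p) (ψ m p)] at h2
  rw [pd_bilin hu hψ, pd_bilin hu hψ]
  linear_combination Real.exp (u p) * (h2 - h1)

theorem curl_bilin (hu : DifferentiableAt ℝ u p) (hψ : ∀ i, DifferentiableAt ℝ (ψ i) p)
    (i m : Fin (n + 1)) :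
    pd 0 (bilin u ψ 1 i m) p - pd 1 (bilin u ψ 0 i m) p = Real.exp (u p) ^ 2 *
      ((inner ℂ (ψ i p) (frameMul 0 (frameMul 1 (dirac u (ψ m) p)))).re
        - (inner ℂ (ψ m p) (frameMul 0 (frameMul 1 (dirac u (ψ i) p)))).re) := by
  have h1 := exp_mul_re_inner_volume_dirac (u := u) (ψ := ψ) (p := p) (ψ i p) m
  have h2 := exp_mul_re_inner_volume_dirac (u := u) (ψ := ψ) (p := p) (ψ m p) i
  rw [re_inner_frameMul_antisymm 0 (ψ i p) (ψ m p),
    re_inner_frameMul_antisymm 1 (ψ i p) (ψ m p)] at h2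
  rw [pd_bilin hu hψ, pd_bilin hu hψ]
  linear_combination Real.exp (u p) * (h2 - h1)

end Bilinears

/-! ### Consequences of the Dirac-harmonic equations -/

namespace IsSmoothKappaDiracHarmonic

variable {n : ℕ} {κ : ℝ} {u : Plane → ℝ} {Ω : Set Plane}
  {φ : Plane → EuclideanSpace ℝ (Fin (n + 1))} {ψ : Fin (n + 1) → Plane → Spinor} {p : Plane}

theorem sum_mul_self (h : IsSmoothKappaDiracHarmonic n κ u Ω φ ψ) (hp : p ∈ Ω) :
    ∑ j, φ p j * φ p j = 1 := by
  have h1 := h.mem_sphere p hp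
  rw [mem_sphere_zero_iff_norm] at h1
  have h2 := EuclideanSpace.norm_sq_eq (φ p)
  rw [h1] at h2
  simpa [← sq] using h2.symm

theorem contDiffOn_coord (h : IsSmoothKappaDiracHarmonic n κ u Ω φ ψ) (i : Fin (n + 1)) :
    ContDiffOn ℝ ∞ (fun q => φ q i) Ω :=
  (EuclideanSpace.proj (𝕜 := ℝ) i).contDiff.comp_contDiffOn h.smooth_map

theorem differentiableAt_coord (h : IsSmoothKappaDiracHarmonic n κ u Ω φ ψ) (hΩ : IsOpen Ω)
    (hp : p ∈ Ω) (i : Fin (n + 1)) : DifferentiableAt ℝ (fun q => φ q i) p :=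
  ((h.contDiffOn_coord i).differentiableOn (by simp)).differentiableAt (hΩ.mem_nhds hp)

theorem differentiableAt_pd_coord (h : IsSmoothKappaDiracHarmonic n κ u Ω φ ψ) (hΩ : IsOpen Ω)
    (hp : p ∈ Ω) (α : Fin 2) (i : Fin (n + 1)) :
    DifferentiableAt ℝ (pd α (fun q => φ q i)) p :=
  ((contDiffOn_pd hΩ (h.contDiffOn_coord i) α).differentiableOn (by simp)).differentiableAt
    (hΩ.mem_nhds hp)

theorem sum_mul_pd (h : IsSmoothKappaDiracHarmonic n κ u Ω φ ψ) (hΩ : IsOpen Ω) (hp : p ∈ Ω)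
    (α : Fin 2) : ∑ j, φ p j * pd α (fun q => φ q j) p = 0 := by
  have h1 : HasFDerivAt (fun q => ∑ j, φ q j * φ q j)
      (∑ j, (φ p j • fderiv ℝ (fun q => φ q j) p + φ p j • fderiv ℝ (fun q => φ q j) p)) p :=
    HasFDerivAt.fun_sum fun j _ =>
      (h.differentiableAt_coord hΩ hp j).hasFDerivAt.fun_mul
        (h.differentiableAt_coord hΩ hp j).hasFDerivAt
  have h2 : HasFDerivAt (fun q => ∑ j, φ q j * φ q j) (0 : Plane →L[ℝ] ℝ) p := by
    refine (hasFDerivAt_const (1 : ℝ) p).congr_of_eventuallyEq ?_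
    filter_upwards [hΩ.mem_nhds hp] with q hq using h.sum_mul_self hq
  have h3 := congrArg (fun L => L (EuclideanSpace.single α 1)) (h1.unique h2)
  simp only [sum_apply, add_apply,
    smul_apply, zero_apply, smul_eq_mul,
    Finset.sum_add_distrib] at h3
  simp only [pd]
  linarith

theorem sum_bilin_mul (h : IsSmoothKappaDiracHarmonic n κ u Ω φ ψ) (hp : p ∈ Ω) (α : Fin 2)
    (i : Fin (n + 1)) : ∑ j, bilin u ψ α i j p * φ p j = 0 := by
  have h1 : ∑ j, bilin u ψ α i j p * φ p j = Real.exp (u p) *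
      (inner ℂ (ψ i p) (frameMul α (∑ j, φ p j • ψ j p))).re := by
    simp only [map_sum, inner_sum, Complex.re_sum, frameMul_real_smul, re_inner_real_smul_right,
      Finset.mul_sum, bilin_eq]
    exact Finset.sum_congr rfl fun j _ => by ring
  rw [h1, h.tangent p hp]
  simp

theorem sum_mul_bilin (h : IsSmoothKappaDiracHarmonic n κ u Ω φ ψ) (hp : p ∈ Ω) (α : Fin 2)
    (m : Fin (n + 1)) : ∑ j, φ p j * bilin u ψ α j m p = 0 := by
  rw [← neg_zero, ← h.sum_bilin_mul hp α m, ← Finset.sum_neg_distrib]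
  exact Finset.sum_congr rfl fun j _ => by rw [bilin_antisymm u ψ α m j]; ring

/-- The equation of the map in the flat coordinates. -/
theorem coordLaplacian_eq (h : IsSmoothKappaDiracHarmonic n κ u Ω φ ψ) (hp : p ∈ Ω)
    (i : Fin (n + 1)) :
    coordLaplacian (fun q => φ q i) p = -(∑ α, ‖pd α φ p‖ ^ 2) * φ p i
      - ∑ j, bilin u ψ 0 i j p * pd 0 (fun q => φ q j) p
      - ∑ j, bilin u ψ 1 i j p * pd 1 (fun q => φ q j) p := by
  have h1 := h.map_eq p hp i
  have he : Real.exp (u p) * Real.exp (-u p) = 1 := by rw [← Real.exp_add]; simp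
  have he2 : Real.exp (-2 * u p) = Real.exp (-u p) ^ 2 := by
    rw [← Real.exp_nat_mul]; congr 1; push_cast; ring
  have hsum (α : Fin 2) : ∑ j, (inner ℂ (ψ i p) (frameMul α (ψ j p))).re
      * frameDeriv u α (fun q => φ q j) p =
      Real.exp (-u p) ^ 2 * ∑ j, bilin u ψ α i j p * pd α (fun q => φ q j) p := by
    rw [Finset.mul_sum]
    refine Finset.sum_congr rfl fun j _ => ?_
    rw [bilin_eq, frameDeriv, smul_eq_mul]
    linear_combination (-((inner ℂ (ψ i p) (frameMul α (ψ j p))).re *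
      pd α (fun q => φ q j) p * Real.exp (-u p))) * he
  have hnorm (α : Fin 2) : ‖frameDeriv u α φ p‖ ^ 2 = Real.exp (-u p) ^ 2 * ‖pd α φ p‖ ^ 2 := by
    rw [frameDeriv, norm_smul, mul_pow, Real.norm_eq_abs, sq_abs]
  simp only [laplaceBeltrami, he2, Fin.sum_univ_two, hsum, hnorm] at h1 ⊢
  have hne : Real.exp (-u p) ^ 2 ≠ 0 := pow_ne_zero _ (Real.exp_pos _).ne'
  apply mul_left_cancel₀ hne
  linear_combination -h1

/-- Kept general in `T` to serve twice: the identity gives the divergence of `S`, the volume element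
`e₁e₂` its curl. -/
theorem exp_sq_mul_re_inner_dirac (h : IsSmoothKappaDiracHarmonic n κ u Ω φ ψ) (hp : p ∈ Ω)
    (T : Spinor →L[ℂ] Spinor) (s : Spinor) (m : Fin (n + 1)) :
    Real.exp (u p) ^ 2 * (inner ℂ s (T (dirac u (ψ m) p))).re =
      -(φ p m * ∑ α, ∑ j, pd α (fun q => φ q j) p *
          (Real.exp (u p) * (inner ℂ s (T (frameMul α (ψ j p)))).re))
        - 2 * κ * (Real.exp (u p) ^ 2 * ((∑ j, ‖ψ j p‖ ^ 2) * (inner ℂ s (T (ψ m p))).re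
          - ∑ j, (inner ℂ (ψ j p) (ψ m p) * inner ℂ s (T (ψ j p))).re)) := by
  have he : Real.exp (u p) * Real.exp (-u p) = 1 := by rw [← Real.exp_add]; simp
  have hT (c : ℝ) (t : Spinor) : T (c • t) = c • T t := by
    rw [← Complex.coe_smul, map_smul, Complex.coe_smul]
  have hsum (α : Fin 2) : ∑ j, pd α (fun q => φ q j) p *
      (Real.exp (u p) * (inner ℂ s (T (frameMul α (ψ j p)))).re) = Real.exp (u p) ^ 2 *
      ∑ j, frameDeriv u α (fun q => φ q j) p * (inner ℂ s (T (frameMul α (ψ j p)))).re := by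
    rw [Finset.mul_sum]
    refine Finset.sum_congr rfl fun j _ => ?_
    rw [frameDeriv, smul_eq_mul]
    linear_combination (-(Real.exp (u p) * pd α (fun q => φ q j) p *
      (inner ℂ s (T (frameMul α (ψ j p)))).re)) * he
  rw [h.spinor_eq p hp m]
  simp only [Fin.sum_univ_two, hsum, map_sub, map_neg, map_add, map_sum, hT, map_smul, inner_sub_right,
    inner_neg_right, inner_add_right, inner_sum, inner_smul_right, Complex.sub_re, Complex.neg_re,
    Complex.add_re, Complex.re_sum, re_inner_real_smul_right]
  ring

/-- The potential contributes nothing: its real pairing with `ψ^i` is symmetric in `i` and `m`,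
while the divergence is antisymmetric. -/
theorem div_bilin_eq (h : IsSmoothKappaDiracHarmonic n κ u Ω φ ψ) (hΩ : IsOpen Ω)
    (hu : ContDiffOn ℝ ∞ u Ω) (hp : p ∈ Ω) (i m : Fin (n + 1)) :
    pd 0 (bilin u ψ 0 i m) p + pd 1 (bilin u ψ 1 i m) p =
      φ p i * ∑ α, ∑ j, pd α (fun q => φ q j) p * bilin u ψ α m j p
        - φ p m * ∑ α, ∑ j, pd α (fun q => φ q j) p * bilin u ψ α i j p := by
  have hud := (hu.differentiableOn (by simp)).differentiableAt (hΩ.mem_nhds hp)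
  have hψd i := ((h.smooth_spinor i).differentiableOn (by simp)).differentiableAt (hΩ.mem_nhds hp)
  have h1 := h.exp_sq_mul_re_inner_dirac hp (.id ℂ _) (ψ i p) m
  have h2 := h.exp_sq_mul_re_inner_dirac hp (.id ℂ _) (ψ m p) i
  have h3 : ∑ j, (inner ℂ (ψ j p) (ψ m p) * inner ℂ (ψ i p) (ψ j p)).re =
      ∑ j, (inner ℂ (ψ j p) (ψ i p) * inner ℂ (ψ m p) (ψ j p)).re := by
    refine Finset.sum_congr rfl fun j _ => ?_
    rw [← Complex.conj_re, map_mul, inner_conj_symm, inner_conj_symm, mul_comm]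
  have h4 := re_inner_comm (ψ i p) (ψ m p)
  simp only [ContinuousLinearMap.id_apply, ← bilin_eq] at h1 h2
  rw [div_bilin hud hψd, mul_sub, h1, h2, h3, h4]
  ring

/-- Pairing the spinor equation through `e₁e₂` exchanges `e₁` and `e₂` up to sign in the `dφ` terms,
and the potential no longer cancels. -/
theorem curl_bilin_eq (h : IsSmoothKappaDiracHarmonic n κ u Ω φ ψ) (hΩ : IsOpen Ω)
    (hu : ContDiffOn ℝ ∞ u Ω) (hp : p ∈ Ω) (i m : Fin (n + 1)) :
    pd 0 (bilin u ψ 1 i m) p - pd 1 (bilin u ψ 0 i m) p =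
      φ p i * (∑ j, pd 0 (fun q => φ q j) p * bilin u ψ 1 m j p
          - ∑ j, pd 1 (fun q => φ q j) p * bilin u ψ 0 m j p)
        - φ p m * (∑ j, pd 0 (fun q => φ q j) p * bilin u ψ 1 i j p
          - ∑ j, pd 1 (fun q => φ q j) p * bilin u ψ 0 i j p)
        + 2 * κ * quarticTerm u ψ i m p := by
  have hud := (hu.differentiableOn (by simp)).differentiableAt (hΩ.mem_nhds hp)
  have hψd i := ((h.smooth_spinor i).differentiableOn (by simp)).differentiableAt (hΩ.mem_nhds hp)
  have h1 := h.exp_sq_mul_re_inner_dirac hp ((frameMul 0).comp (frameMul 1)) (ψ i p) m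
  have h2 := h.exp_sq_mul_re_inner_dirac hp ((frameMul 0).comp (frameMul 1)) (ψ m p) i
  have h3 : ∑ j, (inner ℂ (ψ j p) (ψ i p) * inner ℂ (ψ m p) (frameMul 0 (frameMul 1 (ψ j p)))).re
      = ∑ j, (inner ℂ (ψ i p) (ψ j p) * inner ℂ (frameMul 0 (frameMul 1 (ψ j p))) (ψ m p)).re := by
    refine Finset.sum_congr rfl fun j _ => ?_
    rw [← Complex.conj_re, map_mul, inner_conj_symm, inner_conj_symm]
  have h4 : (inner ℂ (ψ m p) (frameMul 0 (frameMul 1 (ψ i p)))).re =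
      (inner ℂ (frameMul 0 (frameMul 1 (ψ i p))) (ψ m p)).re := re_inner_comm _ _
  -- `e₁e₂` is skew-hermitian, so the two `|ψ|²` terms reinforce each other; hence the factor 2 in
  -- `quarticTerm`.
  have h5 : (inner ℂ (ψ i p) (frameMul 0 (frameMul 1 (ψ m p)))).re =
      -(inner ℂ (frameMul 0 (frameMul 1 (ψ i p))) (ψ m p)).re := by
    rw [inner_frameMul_left, inner_frameMul_left, frameMul_one_zero, inner_neg_right]
    simp
  have h6 (j : Fin (n + 1)) : (inner ℂ (ψ j p) (ψ m p) *
      inner ℂ (ψ i p) (frameMul 0 (frameMul 1 (ψ j p)))).re =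
      (inner ℂ (ψ i p) (frameMul 0 (frameMul 1 (ψ j p))) * inner ℂ (ψ j p) (ψ m p)).re := by
    rw [mul_comm]
  have hc (s : Spinor) : coordMul u 0 p (coordMul u 1 p s) =
      ((Real.exp (u p) ^ 2 : ℝ) : ℂ) • frameMul 0 (frameMul 1 s) := by
    rw [coordMul, coordMul, frameMul_real_smul, smul_smul, ← sq, Complex.coe_smul]
  have hq : quarticTerm u ψ i m p = Real.exp (u p) ^ 2 *
      (2 * (∑ j, ‖ψ j p‖ ^ 2) * (inner ℂ (frameMul 0 (frameMul 1 (ψ i p))) (ψ m p)).re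
      - ∑ j, (inner ℂ (ψ i p) (ψ j p) * inner ℂ (frameMul 0 (frameMul 1 (ψ j p))) (ψ m p)).re
      + ∑ j, (inner ℂ (ψ i p) (frameMul 0 (frameMul 1 (ψ j p))) * inner ℂ (ψ j p) (ψ m p)).re) := by
    have hterm (a b : ℂ) (r : ℝ) : (a * ((r : ℂ) * b)).re = r * (a * b).re := by
      rw [mul_left_comm, Complex.re_ofReal_mul]
    have hterm' (a b : ℂ) (r : ℝ) : ((r : ℂ) * a * b).re = r * (a * b).re := by
      rw [mul_assoc, Complex.re_ofReal_mul]
    have hdouble (r : ℝ) (a : ℂ) : (2 * (r : ℂ) * a).re = 2 * r * a.re := by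
      rw [← Complex.ofReal_ofNat, ← Complex.ofReal_mul, Complex.re_ofReal_mul]
    simp only [quarticTerm, hc, inner_smul_left, inner_smul_right, Complex.conj_ofReal,
      Complex.add_re, Complex.sub_re, Complex.re_sum, hdouble, Complex.re_ofReal_mul, hterm,
      hterm', ← Finset.mul_sum]
    ring
  simp only [ContinuousLinearMap.comp_apply, Fin.sum_univ_two, frameMul_one_zero, map_neg,
    frameMul_zero_zero, frameMul_one_one, neg_neg, inner_neg_right, Complex.neg_re, mul_neg,
    Finset.sum_neg_distrib, ← bilin_eq, h3, h4, h5, h6] at h1 h2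
  rw [curl_bilin hud hψd, mul_sub, h1, h2, hq]
  ring

theorem contDiffOn_noetherCurrent (h : IsSmoothKappaDiracHarmonic n κ u Ω φ ψ) (hΩ : IsOpen Ω)
    (hu : ContDiffOn ℝ ∞ u Ω) (α : Fin 2) (i m : Fin (n + 1)) :
    ContDiffOn ℝ ∞ (noetherCurrent u φ ψ α i m) Ω := by
  rw [funext (noetherCurrent_eq u φ ψ α i m)]
  have hc := h.contDiffOn_coord
  have hd i := contDiffOn_pd hΩ (hc i) α
  exact (contDiffOn_bilin hu h.smooth_spinor α i m).neg.add
    (((hd i).mul (hc m)).sub ((hc i).mul (hd m)))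

theorem pd_noetherCurrent (h : IsSmoothKappaDiracHarmonic n κ u Ω φ ψ) (hΩ : IsOpen Ω)
    (hu : ContDiffOn ℝ ∞ u Ω) (hp : p ∈ Ω) (α β : Fin 2) (i m : Fin (n + 1)) :
    pd β (noetherCurrent u φ ψ α i m) p = -pd β (bilin u ψ α i m) p
      + (pd α (fun q => φ q i) p * pd β (fun q => φ q m) p
        + pd β (pd α (fun q => φ q i)) p * φ p m
        - (φ p i * pd β (pd α (fun q => φ q m)) p
          + pd β (fun q => φ q i) p * pd α (fun q => φ q m) p)) := by
  have hb : DifferentiableAt ℝ (bilin u ψ α i m) p :=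
    ((contDiffOn_bilin hu h.smooth_spinor α i m).differentiableOn (by simp)).differentiableAt
      (hΩ.mem_nhds hp)
  have hc := h.differentiableAt_coord hΩ hp
  have hd := h.differentiableAt_pd_coord hΩ hp α
  rw [funext (noetherCurrent_eq u φ ψ α i m), pd_add hb.fun_neg
    (((hd i).fun_mul (hc m)).fun_sub ((hc i).fun_mul (hd m))), pd_neg,
    pd_sub ((hd i).fun_mul (hc m)) ((hc i).fun_mul (hd m)), pd_mul (hd i) (hc m),
    pd_mul (hc i) (hd m)]

/-- The Noether current is conserved. -/
theorem div_noetherCurrent (h : IsSmoothKappaDiracHarmonic n κ u Ω φ ψ) (hΩ : IsOpen Ω)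
    (hu : ContDiffOn ℝ ∞ u Ω) (hp : p ∈ Ω) (i m : Fin (n + 1)) :
    pd 0 (noetherCurrent u φ ψ 0 i m) p + pd 1 (noetherCurrent u φ ψ 1 i m) p = 0 := by
  have h1 := h.div_bilin_eq hΩ hu hp i m
  have h2 := h.coordLaplacian_eq hp i
  have h3 := h.coordLaplacian_eq hp m
  have hcomm (α : Fin 2) (i : Fin (n + 1)) :
      ∑ j, pd α (fun q => φ q j) p * bilin u ψ α i j p =
        ∑ j, bilin u ψ α i j p * pd α (fun q => φ q j) p :=
    Finset.sum_congr rfl fun j _ => mul_comm _ _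
  simp only [coordLaplacian, Fin.sum_univ_two, hcomm] at h1 h2 h3
  rw [h.pd_noetherCurrent hΩ hu hp, h.pd_noetherCurrent hΩ hu hp]
  -- The `|dφ|²` terms cancel by antisymmetry in `i` and `m`; the spinor forces in the map equation
  -- cancel the divergence of `S`.
  linear_combination -h1 + φ p m * h2 - φ p i * h3

/-- The curl of the Noether current. -/
theorem curl_noetherCurrent (h : IsSmoothKappaDiracHarmonic n κ u Ω φ ψ) (hΩ : IsOpen Ω)
    (hu : ContDiffOn ℝ ∞ u Ω) (hp : p ∈ Ω) (i m : Fin (n + 1)) :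
    pd 1 (noetherCurrent u φ ψ 0 i m) p - pd 0 (noetherCurrent u φ ψ 1 i m) p =
      2 * ∑ j, (noetherCurrent u φ ψ 0 j m p * noetherCurrent u φ ψ 1 i j p
          - noetherCurrent u φ ψ 1 j m p * noetherCurrent u φ ψ 0 i j p)
        - pd 0 (bilin u ψ 1 i m) p + pd 1 (bilin u ψ 0 i m) p
        + 2 * ∑ j, (bilin u ψ 0 i j p * bilin u ψ 1 j m p
            - bilin u ψ 1 i j p * bilin u ψ 0 j m p)
        + 4 * κ * quarticTerm u ψ i m p := by
  have hcurl := h.curl_bilin_eq hΩ hu hp i m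
  have hsum (α β : Fin 2) := sum_current_mul_current (S := fun i m => bilin u ψ α i m p)
    (T := fun i m => bilin u ψ β i m p) (h.sum_mul_self hp) (h.sum_mul_pd hΩ hp α)
    (h.sum_mul_pd hΩ hp β) (h.sum_mul_bilin hp α) (h.sum_bilin_mul hp β) i m
  -- Makes the `φ^i φ^m ⟨φ_x, φ_y⟩` terms cancel between the two orders of multiplication.
  have hdot : ∑ j, pd 1 (fun q => φ q j) p * pd 0 (fun q => φ q j) p =
      ∑ j, pd 0 (fun q => φ q j) p * pd 1 (fun q => φ q j) p :=
    Finset.sum_congr rfl fun j _ => mul_comm _ _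
  have hleft (α β : Fin 2) : ∑ j, pd α (fun q => φ q j) p * bilin u ψ β j m p =
      -∑ j, pd α (fun q => φ q j) p * bilin u ψ β m j p := by
    rw [← Finset.sum_neg_distrib]
    exact Finset.sum_congr rfl fun j _ => by rw [bilin_antisymm u ψ β m j, mul_neg]
  have hright (α β : Fin 2) : ∑ j, bilin u ψ β i j p * pd α (fun q => φ q j) p =
      ∑ j, pd α (fun q => φ q j) p * bilin u ψ β i j p :=
    Finset.sum_congr rfl fun j _ => mul_comm _ _
  simp only [← noetherCurrent_eq, hleft, hright] at hsum
  have h01 := hsum 0 1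
  have h10 := hsum 1 0
  rw [hdot] at h10
  rw [h.pd_noetherCurrent hΩ hu hp, h.pd_noetherCurrent hΩ hu hp,
    pd_comm hΩ (h.contDiffOn_coord i) hp 1 0, pd_comm hΩ (h.contDiffOn_coord m) hp 1 0,
    Finset.sum_sub_distrib, Finset.sum_sub_distrib, h01, h10]
  -- The curl of `S` stands with opposite signs on the two sides, so it is needed twice; this turns
  -- `2κ` into `4κ`.
  linear_combination 2 * hcurl

theorem sum_sum_noetherCurrent_mul (h : IsSmoothKappaDiracHarmonic n κ u Ω φ ψ) (hΩ : IsOpen Ω)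
    (hp : p ∈ Ω) (α β : Fin 2) :
    ∑ m, ∑ i, noetherCurrent u φ ψ α i m p * noetherCurrent u φ ψ β i m p =
      ∑ i, ∑ m, bilin u ψ α i m p * bilin u ψ β i m p
        + 2 * ∑ i, pd α (fun q => φ q i) p * pd β (fun q => φ q i) p := by
  simp only [noetherCurrent_eq]
  exact sum_sum_current_mul_current (S := fun i m => bilin u ψ α i m p)
    (T := fun i m => bilin u ψ β i m p) (h.sum_mul_self hp) (h.sum_mul_pd hΩ hp α)
    (h.sum_mul_pd hΩ hp β) (h.sum_mul_bilin hp α) (h.sum_bilin_mul hp β)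
    (fun i m => bilin_antisymm u ψ α i m p) (fun i m => bilin_antisymm u ψ β i m p)

theorem sum_sum_noetherCurrent_sq (h : IsSmoothKappaDiracHarmonic n κ u Ω φ ψ) (hΩ : IsOpen Ω)
    (hp : p ∈ Ω) (α : Fin 2) :
    ∑ m, ∑ i, noetherCurrent u φ ψ α i m p ^ 2 =
      ∑ i, ∑ m, bilin u ψ α i m p ^ 2 + 2 * ‖pd α φ p‖ ^ 2 := by
  have hφ := (h.smooth_map.differentiableOn (by simp)).differentiableAt (hΩ.mem_nhds hp)
  rw [EuclideanSpace.real_norm_sq_eq]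
  simp only [sq, h.sum_sum_noetherCurrent_mul hΩ hp α α, pd_apply hφ]

end IsSmoothKappaDiracHarmonic

/-! ### Stream functions and the main theorem -/

/-- A smooth divergence-free vector field on a simply connected plane domain has a smooth
stream function. -/
theorem exists_stream_function {Ω : Set Plane} (hΩ : IsOpen Ω) (hsc : SimplyConnectedSpace Ω)
    {X Y : Plane → ℝ} (hX : ContDiffOn ℝ ∞ X Ω) (hY : ContDiffOn ℝ ∞ Y Ω)
    (hdiv : ∀ p ∈ Ω, pd 0 X p + pd 1 Y p = 0) :
    ∃ B : Plane → ℝ, ContDiffOn ℝ ∞ B Ω ∧ ∀ p ∈ Ω, pd 0 B p = -Y p ∧ pd 1 B p = X p := by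
  let e (α : Fin 2) : Plane →L[ℝ] ℝ := EuclideanSpace.proj α
  -- The form `X dy - Y dx`, whose exterior derivative is `(X_x + Y_y) dx ∧ dy`.
  let η : Plane → Plane →L[ℝ] ℝ := fun q => X q • e 1 - Y q • e 0
  have hη : ContDiffOn ℝ ∞ η Ω := (hX.smul contDiffOn_const).sub (hY.smul contDiffOn_const)
  have hηd (p) (hp : p ∈ Ω) (v w : Plane) :
      fderiv ℝ η p v w = fderiv ℝ X p v * w 1 - fderiv ℝ Y p v * w 0 := by
    have hXd := (hX.differentiableOn (by simp)).differentiableAt (hΩ.mem_nhds hp)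
    have hYd := (hY.differentiableOn (by simp)).differentiableAt (hΩ.mem_nhds hp)
    have h1 := (hXd.hasFDerivAt.smul_const (e 1)).fun_sub (hYd.hasFDerivAt.smul_const (e 0))
    rw [HasFDerivAt.fderiv (f := η) h1]
    simp [e]
  have hcoord (L : Plane →L[ℝ] ℝ) (v : Plane) :
      L v = v 0 * L (EuclideanSpace.single 0 1) + v 1 * L (EuclideanSpace.single 1 1) := by
    conv_lhs => rw [show v = v 0 • EuclideanSpace.single 0 (1 : ℝ)
      + v 1 • EuclideanSpace.single 1 (1 : ℝ) by ext k; fin_cases k <;> simp]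
    simp
  obtain ⟨B, hB⟩ := hΩ.exists_forall_hasFDerivAt_of_fderiv_symmetric hsc
    (hη.differentiableOn (by simp)) fun p hp v w => by
      have h0 : fderiv ℝ X p (EuclideanSpace.single 0 1)
        + fderiv ℝ Y p (EuclideanSpace.single 1 1) = 0 := hdiv p hp
      rw [hηd p hp, hηd p hp, hcoord (fderiv ℝ X p) v, hcoord (fderiv ℝ Y p) v,
        hcoord (fderiv ℝ X p) w, hcoord (fderiv ℝ Y p) w]
      linear_combination (v 0 * w 1 - v 1 * w 0) * h0
  -- The primitive inherits smoothness from its derivative `η`.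
  refine ⟨B, (contDiffOn_infty_iff_fderiv_of_isOpen hΩ).mpr
    ⟨fun p hp => (hB p hp).differentiableAt.differentiableWithinAt,
      hη.congr fun p hp => (hB p hp).fderiv⟩, fun p hp => ?_⟩
  rw [pd, pd, (hB p hp).fderiv]
  simp [η, e]

end DiracHarmonic

open DiracHarmonic in
theorem mainTheorem6 (n : ℕ) (κ : ℝ) (Ω : Set Plane) (hΩ : IsOpen Ω)
    (hsc : SimplyConnectedSpace Ω) (u : Plane → ℝ) (hu : ContDiffOn ℝ ∞ u Ω)
    (φ : Plane → EuclideanSpace ℝ (Fin (n + 1))) (ψ : Fin (n + 1) → Plane → Spinor)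
    (h : IsSmoothKappaDiracHarmonic n κ u Ω φ ψ) :
    ∃ B : Fin (n + 1) → Fin (n + 1) → Plane → ℝ,
      (∀ m i, ContDiffOn ℝ ∞ (B m i) Ω) ∧
      (∀ m i, ∀ p ∈ Ω,
        pd 0 (B m i) p = -noetherCurrent u φ ψ 1 i m p ∧
        pd 1 (B m i) p = noetherCurrent u φ ψ 0 i m p) ∧
      (∀ m i, ∀ p ∈ Ω,
        coordLaplacian (B m i) p =
          2 * ∑ j, (pd 0 (B m j) p * pd 1 (B j i) p - pd 1 (B m j) p * pd 0 (B j i) p)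
          - pd 0 (bilin u ψ 1 i m) p + pd 1 (bilin u ψ 0 i m) p
          + 2 * ∑ j, (bilin u ψ 0 i j p * bilin u ψ 1 j m p
              - bilin u ψ 1 i j p * bilin u ψ 0 j m p)
          + 4 * κ * quarticTerm u ψ i m p) ∧
      (∀ p ∈ Ω,
        ∑ m, ∑ i, pd 0 (B m i) p ^ 2 =
          (∑ i, ∑ m, bilin u ψ 1 i m p ^ 2) + 2 * ‖pd 1 φ p‖ ^ 2) ∧
      (∀ p ∈ Ω,
        ∑ m, ∑ i, pd 1 (B m i) p ^ 2 =
          (∑ i, ∑ m, bilin u ψ 0 i m p ^ 2) + 2 * ‖pd 0 φ p‖ ^ 2) ∧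
      (∀ p ∈ Ω,
        ∑ m, ∑ i, pd 0 (B m i) p * pd 1 (B m i) p =
          -(∑ i, ∑ m, bilin u ψ 0 i m p * bilin u ψ 1 i m p)
            - 2 * ∑ i, pd 0 (fun q => φ q i) p * pd 1 (fun q => φ q i) p) := by
  choose B hB hBpd using fun m i => exists_stream_function hΩ hsc
    (h.contDiffOn_noetherCurrent hΩ hu 0 i m) (h.contDiffOn_noetherCurrent hΩ hu 1 i m)
    fun p hp => h.div_noetherCurrent hΩ hu hp i m
  refine ⟨B, hB, hBpd, fun m i p hp => ?_, fun p hp => ?_, fun p hp => ?_, fun p hp => ?_⟩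
  · have h0 : pd 0 (pd 0 (B m i)) p = -pd 0 (noetherCurrent u φ ψ 1 i m) p := by
      rw [← pd_neg]
      exact pd_congr ((hΩ.eventually_mem hp).mono fun q hq => (hBpd m i q hq).1)
    have h1 : pd 1 (pd 1 (B m i)) p = pd 1 (noetherCurrent u φ ψ 0 i m) p :=
      pd_congr ((hΩ.eventually_mem hp).mono fun q hq => (hBpd m i q hq).2)
    -- `B^{mj}` comes from `J^{jm}`: the transposed indices and the sign in `B_x = -J_y` together
    -- preserve the form of the determinant.
    have hsum : ∑ j, (pd 0 (B m j) p * pd 1 (B j i) p - pd 1 (B m j) p * pd 0 (B j i) p) =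
        ∑ j, (noetherCurrent u φ ψ 0 j m p * noetherCurrent u φ ψ 1 i j p
          - noetherCurrent u φ ψ 1 j m p * noetherCurrent u φ ψ 0 i j p) :=
      Finset.sum_congr rfl fun j _ => by
        rw [(hBpd m j p hp).1, (hBpd m j p hp).2, (hBpd j i p hp).1, (hBpd j i p hp).2]
        ring
    rw [hsum, ← h.curl_noetherCurrent hΩ hu hp, coordLaplacian, Fin.sum_univ_two, h0, h1]
    ring
  · simp only [(hBpd _ _ p hp).1, neg_sq, h.sum_sum_noetherCurrent_sq hΩ hp 1]
  · simp only [(hBpd _ _ p hp).2, h.sum_sum_noetherCurrent_sq hΩ hp 0]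
  · have hsum : ∑ m, ∑ i, pd 0 (B m i) p * pd 1 (B m i) p =
        -∑ m, ∑ i, noetherCurrent u φ ψ 0 i m p * noetherCurrent u φ ψ 1 i m p := by
      simp only [← Finset.sum_neg_distrib]
      refine Finset.sum_congr rfl fun m _ => Finset.sum_congr rfl fun i _ => ?_
      rw [(hBpd m i p hp).1, (hBpd m i p hp).2]
      ring
    rw [hsum, h.sum_sum_noetherCurrent_mul hΩ hp]
    ring
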